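/- Let $K$ be a field and let $G$ be a finite graph with vertex set $[n]$ and edge set $E(G)$; loops are allowed, parallel edges are not. Put $R=K[x_1,\dots,x_n]$ and let $I(G)=(x_ix_j : \{i,j\}\in E(G))\subseteq R$ be the edge ideal (a loop at $i$ contributes $x_i^2$). *Conductor.* For an ideal $I=(f_1,\dots,f_m)$ of $R$ let $T=R[y_1,\dots,y_m]$, let $J$ be the kernel of the $R$-algebra homomorphism $T\to R[t]$, $y_j\mapsto f_jt$, and let $L\subseteq J$ be the ideal of $T$ generated by the linear forms $\sum_j a_jy_j$ with $a_j\in R$ and $\sum_j a_jf_j=0$. The conductor of $I$ is the ideal $C(I)=\{r\in R : rJ\subseteq L\}$ (it does not depend on the choice of generators). *Walks.* An even closed walk $\Gamma$ of length $2q>0$ in $G$ is a sequence of edges $e_k=\{j_k,j_{k+1}\}\in E(G)$, $k=1,\dots,2q$, with $j_{2q+1}=j_1$; its vertices are $j_1,\dots,j_{2q}$. In the polynomial ring $K[y_e : e\in E(G)]$ put $h_\Gamma^+=\prod_{k=1}^q y_{e_{2k-1}}$, $h_\Gamma^-=\prod_{k=1}^q y_{e_{2k}}$ and $h_\Gamma=h_\Gamma^+-h_\Gamma^-$.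 The walk $\Gamma$ is trivial if $h_\Gamma=0$, and primitive if there is no even closed walk $\Gamma'$ with $h_{\Gamma'}\neq h_\Gamma$, $h_{\Gamma'}^+\mid h_\Gamma^+$ and $h_{\Gamma'}^-\mid h_\Gamma^-$. Let $N_\Gamma\subseteq R$ be the ideal generated by the variables $x_i$ such that $i$ is adjacent to some vertex of $\Gamma$ (that is, $\{i,v\}\in E(G)$ for some vertex $v$ of $\Gamma$). **Theorem.** For every generating system $f_1,\dots,f_m$ of $I(G)$, the conductor of $I(G)$ is $$C(I(G)) = I(G)+\bigcap_{\Gamma}N_\Gamma ,$$ where $\Gamma$ runs over all non-trivial primitive even closed walks of $G$ (the empty intersection is $R$). -/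

import Mathlib

namespace EdgeConductor

section Conductor

variable {R : Type*} [CommRing R] {m : ℕ}

/-- The `R`-algebra homomorphism `φ : T = R[y_1, …, y_m] → R[t]`, `y_j ↦ f_j t`; its image is the
Rees algebra of the ideal `(f_1, …, f_m)`. -/
noncomputable def reesMap (f : Fin m → R) : MvPolynomial (Fin m) R →ₐ[R] Polynomial R :=
  MvPolynomial.aeval fun j => Polynomial.C (f j) * Polynomial.X

/-- The defining ideal `J = Ker φ ⊆ T` of the Rees algebra of `(f_1, …, f_m)`. -/
noncomputable def reesIdeal (f : Fin m → R) : Ideal (MvPolynomial (Fin m) R) :=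
  RingHom.ker (reesMap f)

/-- The ideal `L ⊆ T` generated by the linear relations `∑ a_j y_j`, where `∑ a_j f_j = 0`. -/
noncomputable def linearIdeal (f : Fin m → R) : Ideal (MvPolynomial (Fin m) R) :=
  Ideal.span {p | ∃ a : Fin m → R, ∑ j, a j * f j = 0 ∧
    p = ∑ j, MvPolynomial.C (a j) * MvPolynomial.X j}

/-- The conductor `{r ∈ R : r J ⊆ L}` of the ideal `(f_1, …, f_m)`. -/
noncomputable def conductor (f : Fin m → R) : Ideal R where
  carrier := {r | ∀ p ∈ reesIdeal f, MvPolynomial.C r * p ∈ linearIdeal f}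
  add_mem' {a b} ha hb p hp := by
    rw [map_add, add_mul]
    exact add_mem (ha p hp) (hb p hp)
  zero_mem' p _ := by simp
  smul_mem' c r hr p hp := by
    rw [smul_eq_mul, map_mul, mul_assoc]
    exact Ideal.mul_mem_left _ _ (hr p hp)

end Conductor

section Graph

variable {V : Type*}

/-- The edge ideal `(x_i x_j : {i, j} ∈ E)` in `K[x_i : i ∈ V]` of the graph on `V` with edge set
`E`. A set of unordered pairs allows loops `{i, i}`, but no parallel edges. -/
noncomputable def edgeIdeal (K : Type*) [Field K] (E : Set (Sym2 V)) :
    Ideal (MvPolynomial V K) :=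
  Ideal.span {p | ∃ i j : V, s(i, j) ∈ E ∧ p = MvPolynomial.X i * MvPolynomial.X j}

/-- An even closed walk of length `2 q > 0`: its vertices `j_0, j_1, …, j_{2 q - 1}` are written as
a `2 q`-periodic sequence, consecutive members of which are joined by an edge. -/
structure EvenClosedWalk (E : Set (Sym2 V)) where
  /-- Half of the length. -/
  q : ℕ
  q_pos : 0 < q
  /-- The vertices in their cyclic order. -/
  vertex : ℕ → V
  periodic : Function.Periodic vertex (2 * q)
  edge_mem : ∀ k, s(vertex k, vertex (k + 1)) ∈ E

namespace EvenClosedWalk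

variable {E : Set (Sym2 V)} (K : Type*) [Field K]

/-- The `k`-th edge of the walk, counted from `0`. -/
def edge (Γ : EvenClosedWalk E) (k : ℕ) : E :=
  ⟨s(Γ.vertex k, Γ.vertex (k + 1)), Γ.edge_mem k⟩

/-- The product of the variables of the first, third, fifth, … edge, in `K[y_e : e ∈ E]`. -/
noncomputable def hPlus (Γ : EvenClosedWalk E) : MvPolynomial E K :=
  ∏ k ∈ Finset.range Γ.q, MvPolynomial.X (Γ.edge (2 * k))

/-- The product of the variables of the second, fourth, sixth, … edge, in `K[y_e : e ∈ E]`. -/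
noncomputable def hMinus (Γ : EvenClosedWalk E) : MvPolynomial E K :=
  ∏ k ∈ Finset.range Γ.q, MvPolynomial.X (Γ.edge (2 * k + 1))

/-- The binomial of the walk. -/
noncomputable def h (Γ : EvenClosedWalk E) : MvPolynomial E K :=
  Γ.hPlus K - Γ.hMinus K

def IsTrivial (Γ : EvenClosedWalk E) : Prop :=
  Γ.h K = 0

def IsPrimitive (Γ : EvenClosedWalk E) : Prop :=
  ¬ ∃ Γ' : EvenClosedWalk E,
    Γ.h K ≠ Γ'.h K ∧ Γ'.hPlus K ∣ Γ.hPlus K ∧ Γ'.hMinus K ∣ Γ.hMinus K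

/-- The ideal generated by the variables `x_i` with `i` adjacent to some vertex of the walk. -/
noncomputable def nbhdIdeal (Γ : EvenClosedWalk E) : Ideal (MvPolynomial V K) :=
  Ideal.span {p | ∃ i : V, (∃ k, s(i, Γ.vertex k) ∈ E) ∧ p = MvPolynomial.X i}

end EvenClosedWalk

end Graph

end EdgeConductor

/-! The conductor depends only on the ideal, so the generators may be taken to be the edge
monomials. Let `J` and `L` be the ideals of the Rees algebra and of the linear relations for these
generators.

`J` is generated by `L` and the binomials `h_Γ` of the non-trivial primitive walks
(`mem_of_reesHom_eq_zero`). Modulo `L`, `x^a y_e` may be exchanged for `x^b y_{e'}` whenever both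
have the same image. Such exchanges create common edges, which cancel, until only a binomial `y^u -
y^v` with equal vertex degrees is left (`mk_bimonomial_eq_of_toric`). Walking alternately along `u`
and `v` finds an even closed walk in it, and induction on the degree leaves only primitive walks
(`mk_bimonomial_eq_of_primitive`). Hence `r` is in the conductor exactly when `r h_Γ ∈ L` for all
these `Γ`.

If `i` is adjacent to a vertex of `Γ`, then passing exchanges once around the walk turns `x_i h_Γ⁺`
into `x_i h_Γ⁻`; an edge monomial in place of `x_i` works too (`mk_bimonomial_walk`). Conversely, if
no edge monomial divides `x^a` and no variable of `x^a` is adjacent to `Γ`, then no exchange applies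
to `x^a h_Γ⁺`, so this monomial occurs in no element of `L` (`coeff_eq_zero_of_mem_relationIdeal`).
It would occur in `r h_Γ` if `x^a` occurred in `r`. -/

namespace EdgeConductor

/-! ### Independence of the conductor from the generating system -/

section GeneratingSystems

variable {R : Type*} [CommRing R] {ι κ : Type*}

/-- The `R`-algebra homomorphism `R[y_j : j ∈ ι] → R[t]`, `y_j ↦ g_j t`, for any index type. -/
noncomputable def reesHom (g : ι → R) : MvPolynomial ι R →ₐ[R] Polynomial R :=
  MvPolynomial.aeval fun j => Polynomial.C (g j) * Polynomial.X

/-- The ideal generated by the linear relations of the family `g`, for any finite index type. -/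
noncomputable def relationIdeal [Fintype ι] (g : ι → R) : Ideal (MvPolynomial ι R) :=
  Ideal.span {p | ∃ a : ι → R, ∑ j, a j * g j = 0 ∧
    p = ∑ j, MvPolynomial.C (a j) * MvPolynomial.X j}

lemma mem_relationIdeal [Fintype ι] {g : ι → R} (a : ι → R) (h : ∑ j, a j * g j = 0) :
    ∑ j, MvPolynomial.C (a j) * MvPolynomial.X j ∈ relationIdeal g :=
  Ideal.subset_span ⟨a, h, rfl⟩

variable [Fintype κ]

/-- The substitution `y_j ↦ ∑ k, c_{j k} z_k`. -/
noncomputable def linearSubst (c : ι → κ → R) : MvPolynomial ι R →ₐ[R] MvPolynomial κ R :=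
  MvPolynomial.aeval fun j => ∑ k, MvPolynomial.C (c j k) * MvPolynomial.X k

lemma reesHom_linearSubst {f : ι → R} {g : κ → R} {c : ι → κ → R}
    (hc : ∀ j, ∑ k, c j k * g k = f j) (p : MvPolynomial ι R) :
    reesHom g (linearSubst c p) = reesHom f p := by
  have : (reesHom g).comp (linearSubst c) = reesHom f := by
    refine MvPolynomial.algHom_ext fun j => ?_
    simp only [reesHom, linearSubst, AlgHom.comp_apply, MvPolynomial.aeval_X, map_sum, map_mul,
      MvPolynomial.algHom_C, ← hc j, Finset.sum_mul, Polynomial.algebraMap_eq, mul_assoc]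
  exact DFunLike.congr_fun this p

variable [Fintype ι]

lemma linearSubst_linearForm (c : ι → κ → R) (a : ι → R) :
    linearSubst c (∑ j, MvPolynomial.C (a j) * MvPolynomial.X j) =
      ∑ k, MvPolynomial.C (∑ j, a j * c j k) * MvPolynomial.X k := by
  simp only [linearSubst, map_sum, map_mul, MvPolynomial.algHom_C, MvPolynomial.aeval_X,
    MvPolynomial.algebraMap_eq, Finset.mul_sum, Finset.sum_mul]
  rw [Finset.sum_comm]
  simp only [mul_assoc]

lemma linearSubst_mem_relationIdeal {f : ι → R} {g : κ → R} {c : ι → κ → R}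
    (hc : ∀ j, ∑ k, c j k * g k = f j) {p : MvPolynomial ι R} (hp : p ∈ relationIdeal f) :
    linearSubst c p ∈ relationIdeal g := by
  suffices h : relationIdeal f ≤ (relationIdeal g).comap (linearSubst c) from h hp
  refine Ideal.span_le.2 ?_
  rintro _ ⟨a, ha, rfl⟩
  rw [SetLike.mem_coe, Ideal.mem_comap, linearSubst_linearForm]
  refine mem_relationIdeal _ ?_
  rw [← ha]
  simp only [← hc, Finset.sum_mul, Finset.mul_sum]
  rw [Finset.sum_comm]
  simp only [mul_assoc]

/-- It suffices to treat a variable `y_j`: it and its image under the double substitution are linear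
forms with the same value `f j`, so their difference is a linear relation. -/
lemma sub_linearSubst_mem {f : ι → R} {g : κ → R} {c : ι → κ → R} {d : κ → ι → R}
    (hc : ∀ j, ∑ k, c j k * g k = f j) (hd : ∀ k, ∑ j, d k j * f j = g k)
    (p : MvPolynomial ι R) : p - linearSubst d (linearSubst c p) ∈ relationIdeal f := by
  classical
  rw [← Ideal.Quotient.eq]
  have : (Ideal.Quotient.mkₐ R (relationIdeal f)) =
      (Ideal.Quotient.mkₐ R (relationIdeal f)).comp ((linearSubst d).comp (linearSubst c)) := by
    refine MvPolynomial.algHom_ext fun j => ?_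
    simp only [AlgHom.comp_apply, Ideal.Quotient.mkₐ_eq_mk]
    rw [Ideal.Quotient.eq]
    have h1 : linearSubst c (MvPolynomial.X j : MvPolynomial ι R) =
        ∑ k, MvPolynomial.C (c j k) * MvPolynomial.X k := by
      simp [linearSubst]
    have h2 : (MvPolynomial.X j : MvPolynomial ι R) =
        ∑ i, MvPolynomial.C ((Pi.single j 1 : ι → R) i) * MvPolynomial.X i := by
      rw [Finset.sum_eq_single j] <;> simp +contextual
    rw [h1, linearSubst_linearForm]
    nth_rewrite 1 [h2]
    rw [← Finset.sum_sub_distrib]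
    simp only [← sub_mul, ← map_sub]
    refine mem_relationIdeal (fun i => (Pi.single j 1 : ι → R) i - ∑ k, c j k * d k i) ?_
    simp only [sub_mul, Finset.sum_sub_distrib, Finset.sum_mul]
    rw [Finset.sum_comm]
    simp only [mul_assoc, ← Finset.mul_sum, hd, hc]
    simp [Pi.single_apply]
  exact DFunLike.congr_fun this p

/-- The conductor depends only on the ideal and not on its generators. -/
lemma mul_mem_relationIdeal_of_span_eq {f : ι → R} {g : κ → R}
    (h : Ideal.span (Set.range f) = Ideal.span (Set.range g)) {r : R}
    (hr : ∀ p, reesHom g p = 0 → MvPolynomial.C r * p ∈ relationIdeal g)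
    (p : MvPolynomial ι R) (hp : reesHom f p = 0) : MvPolynomial.C r * p ∈ relationIdeal f := by
  have hf : ∀ j, ∃ c : κ → R, ∑ k, c k * g k = f j := fun j =>
    Ideal.mem_span_range_iff_exists_fun.1 (h ▸ Ideal.subset_span ⟨j, rfl⟩)
  have hg : ∀ k, ∃ d : ι → R, ∑ j, d j * f j = g k := fun k =>
    Ideal.mem_span_range_iff_exists_fun.1 (h ▸ Ideal.subset_span ⟨k, rfl⟩)
  choose c hc using hf
  choose d hd using hg
  -- Multiply by `r` after passing to the variables of `g`, return to those of `f`, and correct by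
  -- `r` times the error of the round trip.
  have h1 := hr (linearSubst c p) (by rw [reesHom_linearSubst hc, hp])
  have h2 := linearSubst_mem_relationIdeal hd h1
  have h3 := Ideal.mul_mem_left _ (MvPolynomial.C r) (sub_linearSubst_mem hc hd p)
  have h4 : linearSubst d (MvPolynomial.C r) = MvPolynomial.C r := by
    simp [linearSubst]
  rw [map_mul, h4] at h2
  have := add_mem h2 h3
  rwa [← mul_add, add_sub_cancel] at this

lemma mem_conductor_iff {m : ℕ} {f : Fin m → R} {g : κ → R}
    (h : Ideal.span (Set.range f) = Ideal.span (Set.range g)) {r : R} :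
    r ∈ conductor f ↔ ∀ p, reesHom g p = 0 → MvPolynomial.C r * p ∈ relationIdeal g :=
  ⟨fun hr => mul_mem_relationIdeal_of_span_eq h.symm hr,
    fun hr => mul_mem_relationIdeal_of_span_eq h hr⟩

end GeneratingSystems

/-! ### Edge multisets and alternating walks -/

section Graph

open Finsupp

variable {V : Type*}

/-- The exponent `δ_i + δ_j` of the monomial `x_i x_j` of the edge `{i, j}`. -/
noncomputable def ends (e : Sym2 V) : V →₀ ℕ :=
  e.lift ⟨fun i j => single i 1 + single j 1, fun _ _ => add_comm _ _⟩

@[simp] lemma ends_mk (i j : V) : ends s(i, j) = single i 1 + single j 1 := rfl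

lemma degree_ends (e : Sym2 V) : (ends e).degree = 2 := by
  induction e with
  | h i j => simp

lemma exists_eq_mk_of_ends_ne_zero {e : Sym2 V} {i : V} (h : ends e i ≠ 0) :
    ∃ j, e = s(i, j) := by
  classical
  induction e with
  | h a b =>
    by_cases ha : a = i
    · exact ⟨b, by rw [ha]⟩
    · by_cases hb : b = i
      · exact ⟨a, by rw [hb, Sym2.eq_swap]⟩
      · simp [ha, hb] at h

variable {E : Set (Sym2 V)}

/-- The vertex degrees of a multiset of edges. -/
noncomputable def vertexDegree : (E →₀ ℕ) →ₗ[ℕ] (V →₀ ℕ) :=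
  Finsupp.linearCombination ℕ fun e : E => ends e.1

@[simp] lemma vertexDegree_single (e : E) : vertexDegree (single e 1) = ends e.1 := by
  simp [vertexDegree]

/-- The handshake lemma, a loop counting twice at its vertex. It makes multisets with equal vertex
degrees equally large. -/
lemma degree_vertexDegree (u : E →₀ ℕ) : (vertexDegree u).degree = 2 * u.degree := by
  induction u using Finsupp.induction_linear with
  | zero => simp
  | add u v hu hv => rw [map_add, map_add, map_add, hu, hv]; ring
  | single e n => simp [vertexDegree, degree_ends, mul_comm]

lemma exists_edge_of_vertexDegree_ne_zero {u : E →₀ ℕ} {i : V} (h : vertexDegree u i ≠ 0) :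
    ∃ (e : E) (j : V) (u' : E →₀ ℕ), e.1 = s(i, j) ∧ u = single e 1 + u' := by
  rw [vertexDegree, Finsupp.linearCombination_apply, Finsupp.sum, Finsupp.finsetSum_apply] at h
  obtain ⟨e, he, hne⟩ := Finset.exists_ne_zero_of_sum_ne_zero h
  obtain ⟨j, hj⟩ := exists_eq_mk_of_ends_ne_zero (e := e.1) (i := i)
    (fun h0 => hne (by simp [h0]))
  have hle : single e 1 ≤ u := by
    rw [Finsupp.single_le_iff]
    exact Nat.one_le_iff_ne_zero.2 (Finsupp.mem_support_iff.1 he)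
  obtain ⟨u', hu'⟩ := exists_add_of_le hle
  exact ⟨e, j, u', hj, hu'⟩

lemma exists_edge_of_ne_zero {u : E →₀ ℕ} (h : u ≠ 0) :
    ∃ (e : E) (u' : E →₀ ℕ), u = single e 1 + u' := by
  obtain ⟨e, he⟩ := Finsupp.ne_iff.1 h
  have hle : single e 1 ≤ u := by
    rw [Finsupp.single_le_iff]
    exact Nat.one_le_iff_ne_zero.2 he
  obtain ⟨u', hu'⟩ := exists_add_of_le hle
  exact ⟨e, u', hu'⟩

/-- There is a walk of length `2 q` from `k` to `i` whose odd edges are part of `u` and whose even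
edges are part of `v`. -/
def HasAlternatingWalk (u v : E →₀ ℕ) (q : ℕ) (k i : V) : Prop :=
  ∃ (w : ℕ → V) (ε : ℕ → E), w 0 = k ∧ w (2 * q) = i ∧
    (∀ t < 2 * q, (ε t : Sym2 V) = s(w t, w (t + 1))) ∧
    ∑ t ∈ Finset.range q, single (ε (2 * t)) 1 ≤ u ∧
    ∑ t ∈ Finset.range q, single (ε (2 * t + 1)) 1 ≤ v

lemma HasAlternatingWalk.cons {u v : E →₀ ℕ} {q : ℕ} {m i : V}
    (h : HasAlternatingWalk u v q m i) {e e' : E} {k l : V} (he : e.1 = s(k, l))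
    (he' : e'.1 = s(l, m)) :
    HasAlternatingWalk (single e 1 + u) (single e' 1 + v) (q + 1) k i := by
  obtain ⟨w, ε, h0, h1, hε, hu, hv⟩ := h
  refine ⟨fun | 0 => k | 1 => l | t + 2 => w t, fun | 0 => e | 1 => e' | t + 2 => ε t,
    rfl, h1, ?_, ?_, ?_⟩
  · rintro (_ | _ | t) ht
    · exact he
    · simpa [h0] using he'
    · exact hε t (by omega)
  · rw [Finset.sum_range_succ', add_comm]
    exact add_le_add le_rfl hu
  · rw [Finset.sum_range_succ', add_comm]
    exact add_le_add le_rfl hv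

/-- Two steps of a walk from `k` towards `i`: once `e` is used up, the balance of degrees forces an
edge of `v` at `l`, and using that edge restores the same balance with `m` in place of `k`. -/
lemma exists_cons_of_vertexDegree_eq {u v : E →₀ ℕ} {i k l : V} {e : E} (he : e.1 = s(k, l))
    (h : single i 1 + vertexDegree (single e 1 + u) = single k 1 + vertexDegree v) :
    ∃ (e' : E) (m : V) (v' : E →₀ ℕ), e'.1 = s(l, m) ∧ v = single e' 1 + v' ∧
      single i 1 + vertexDegree u = single m 1 + vertexDegree v' := by
  have h' : single i 1 + vertexDegree u + single l 1 = vertexDegree v := by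
    rw [map_add, vertexDegree_single, he, ends_mk] at h
    apply add_left_cancel (a := single k 1)
    rw [← h]; abel
  have hl : vertexDegree v l ≠ 0 := by
    rw [← h']; simp
  obtain ⟨e', m, v', he', rfl⟩ := exists_edge_of_vertexDegree_ne_zero hl
  refine ⟨e', m, v', he', rfl, ?_⟩
  rw [map_add, vertexDegree_single, he', ends_mk] at h'
  apply add_right_cancel (b := single l 1)
  rw [h']; abel

lemma exists_hasAlternatingWalk [Nonempty E] (n : ℕ) (u v : E →₀ ℕ) (i k : V)
    (hn : u.degree = n) (h : single i 1 + vertexDegree u = single k 1 + vertexDegree v) :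
    ∃ q, HasAlternatingWalk u v q k i := by
  classical
  induction n generalizing u v k with
  | zero =>
    have hu : u = 0 := (Finsupp.degree_eq_zero_iff u).1 hn
    have hk : k = i := by
      by_contra hne
      have := DFunLike.congr_fun h k
      simp [hu, Ne.symm hne] at this
      omega
    exact ⟨0, fun _ => k, fun _ => Classical.arbitrary _, rfl, hk, by simp, by simp, by simp⟩
  | succ n ih =>
    by_cases hk : k = i
    · exact ⟨0, fun _ => k, fun _ => Classical.arbitrary _, rfl, hk, by simp, by simp, by simp⟩
    -- Away from the target, the extra `single k 1` on the right can only be balanced by an edge of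
    -- `u` at `k`.
    have hu : vertexDegree u k ≠ 0 := by
      have := DFunLike.congr_fun h k
      simp only [Finsupp.add_apply, Finsupp.single_apply, Ne.symm hk, if_true, if_false] at this
      omega
    obtain ⟨e, l, u', he, rfl⟩ := exists_edge_of_vertexDegree_ne_zero hu
    obtain ⟨e', m, v', he', rfl, h'⟩ := exists_cons_of_vertexDegree_eq he h
    obtain ⟨q, hq⟩ := ih u' v' m (by simp at hn; omega) h'
    exact ⟨q + 1, hq.cons he he'⟩

namespace EvenClosedWalk

/-- The exponent of `h_Γ⁺`. -/
noncomputable def plusExp (Γ : EvenClosedWalk E) : E →₀ ℕ :=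
  ∑ k ∈ Finset.range Γ.q, single (Γ.edge (2 * k)) 1

/-- The exponent of `h_Γ⁻`. -/
noncomputable def minusExp (Γ : EvenClosedWalk E) : E →₀ ℕ :=
  ∑ k ∈ Finset.range Γ.q, single (Γ.edge (2 * k + 1)) 1

lemma coe_edge (Γ : EvenClosedWalk E) (k : ℕ) :
    (Γ.edge k : Sym2 V) = s(Γ.vertex k, Γ.vertex (k + 1)) := rfl

lemma hPlus_eq (K : Type*) [Field K] (Γ : EvenClosedWalk E) :
    Γ.hPlus K = MvPolynomial.monomial Γ.plusExp 1 := by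
  rw [hPlus, plusExp, MvPolynomial.monomial_sum_one]
  rfl

lemma hMinus_eq (K : Type*) [Field K] (Γ : EvenClosedWalk E) :
    Γ.hMinus K = MvPolynomial.monomial Γ.minusExp 1 := by
  rw [hMinus, minusExp, MvPolynomial.monomial_sum_one]
  rfl

lemma isTrivial_iff (K : Type*) [Field K] (Γ : EvenClosedWalk E) :
    Γ.IsTrivial K ↔ Γ.plusExp = Γ.minusExp := by
  rw [IsTrivial, h, sub_eq_zero, hPlus_eq, hMinus_eq]
  exact (MvPolynomial.monomial_left_injective one_ne_zero).eq_iff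

lemma degree_plusExp (Γ : EvenClosedWalk E) : Γ.plusExp.degree = Γ.q := by
  simp [plusExp, map_sum]

lemma vertexDegree_plusExp (Γ : EvenClosedWalk E) :
    vertexDegree Γ.plusExp = vertexDegree Γ.minusExp := by
  simp only [plusExp, minusExp, map_sum, vertexDegree_single, coe_edge, ends_mk,
    Finset.sum_add_distrib]
  rw [add_comm]
  congr 1
  have h := Finset.sum_range_succ (fun t => single (Γ.vertex (2 * t)) 1) Γ.q
  rw [Finset.sum_range_succ'] at h
  have hp : Γ.vertex (2 * Γ.q) = Γ.vertex (2 * 0) := by simpa using Γ.periodic 0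
  rw [hp] at h
  exact (add_right_cancel h).symm

/-- The walk starting at the second vertex. -/
def rotate (Γ : EvenClosedWalk E) : EvenClosedWalk E where
  q := Γ.q
  q_pos := Γ.q_pos
  vertex k := Γ.vertex (k + 1)
  periodic k := by
    beta_reduce
    rw [add_right_comm]
    exact Γ.periodic (k + 1)
  edge_mem k := Γ.edge_mem (k + 1)

lemma edge_periodic (Γ : EvenClosedWalk E) : Function.Periodic Γ.edge (2 * Γ.q) := fun k =>
  Subtype.ext (by
    rw [coe_edge, coe_edge, Γ.periodic k, add_right_comm, Γ.periodic (k + 1)])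

lemma plusExp_rotate (Γ : EvenClosedWalk E) : Γ.rotate.plusExp = Γ.minusExp := rfl

lemma minusExp_rotate (Γ : EvenClosedWalk E) : Γ.rotate.minusExp = Γ.plusExp := by
  have h := Finset.sum_range_succ (fun t => single (Γ.edge (2 * t)) 1) Γ.q
  rw [Finset.sum_range_succ'] at h
  have hp : Γ.edge (2 * Γ.q) = Γ.edge (2 * 0) := by simpa using Γ.edge_periodic 0
  rw [hp] at h
  exact add_right_cancel h

lemma exists_of_mem_support_plusExp (Γ : EvenClosedWalk E) {e : E}
    (he : e ∈ Γ.plusExp.support) : ∃ k, e = Γ.edge k := by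
  classical
  rw [plusExp, Finsupp.mem_support_iff, Finsupp.finsetSum_apply] at he
  obtain ⟨k, -, hk⟩ := Finset.exists_ne_zero_of_sum_ne_zero he
  refine ⟨2 * k, ?_⟩
  by_contra hne
  exact hk (Finsupp.single_eq_of_ne hne)

end EvenClosedWalk

lemma HasAlternatingWalk.exists_evenClosedWalk {u v : E →₀ ℕ} {q : ℕ} {i : V}
    (h : HasAlternatingWalk u v q i i) (hq : 0 < q) :
    ∃ Γ : EvenClosedWalk E, Γ.plusExp ≤ u ∧ Γ.minusExp ≤ v := by
  obtain ⟨w, ε, h0, h1, hε, hu, hv⟩ := h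
  have hmod : ∀ t, t < 2 * q → w ((t + 1) % (2 * q)) = w (t + 1) := by
    intro t ht
    rcases (Nat.succ_le_of_lt ht).lt_or_eq with h | h
    · rw [Nat.mod_eq_of_lt h]
    · rw [show t + 1 = 2 * q from h, Nat.mod_self, h0, h1]
  have key : ∀ t, (ε (t % (2 * q)) : Sym2 V) = s(w (t % (2 * q)), w ((t + 1) % (2 * q))) := by
    intro t
    have ht := Nat.mod_lt t (show 0 < 2 * q by omega)
    rw [hε _ ht, ← hmod _ ht, Nat.mod_add_mod]
  -- Indices are reduced modulo `2 * q`; `hmod` handles the closing step, where `w (2 * q) = w 0`.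
  let Γ : EvenClosedWalk E :=
    { q := q
      q_pos := hq
      vertex := fun t => w (t % (2 * q))
      periodic := fun t => by simp
      edge_mem := fun t => key t ▸ (ε _).2 }
  have hedge : ∀ t < 2 * q, Γ.edge t = ε t := fun t ht => Subtype.ext (by
    have := key t
    rw [Nat.mod_eq_of_lt ht] at this
    rw [this, EvenClosedWalk.coe_edge]
    simp only [Γ, Nat.mod_eq_of_lt ht])
  refine ⟨Γ, ?_, ?_⟩
  · refine le_of_eq_of_le (Finset.sum_congr rfl fun t ht => ?_) hu
    rw [hedge _ (by have := Finset.mem_range.1 ht; change t < q at this; omega)]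
  · refine le_of_eq_of_le (Finset.sum_congr rfl fun t ht => ?_) hv
    rw [hedge _ (by have := Finset.mem_range.1 ht; change t < q at this; omega)]

/-- Two nonempty multisets of edges with equal vertex degrees contain the odd and the even edges
of an even closed walk. -/
lemma exists_evenClosedWalk_le {u v : E →₀ ℕ} (h : vertexDegree u = vertexDegree v)
    (hu : u ≠ 0) : ∃ Γ : EvenClosedWalk E, Γ.plusExp ≤ u ∧ Γ.minusExp ≤ v := by
  obtain ⟨⟨e, heE⟩, u, rfl⟩ := exists_edge_of_ne_zero hu
  induction e with
  | h k l =>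
    have : Nonempty E := ⟨⟨_, heE⟩⟩
    -- The first two edges are taken by hand with start and target both `k`; the general search
    -- would stop there at once with length zero.
    obtain ⟨e', m, v', he', rfl, h'⟩ :=
      exists_cons_of_vertexDegree_eq (v := v) (i := k) (k := k) (l := l) (e := ⟨s(k, l), heE⟩) rfl
        (by rw [h])
    obtain ⟨q, hq⟩ := exists_hasAlternatingWalk _ u v' k m rfl h'
    exact (hq.cons (k := k) (l := l) (e := ⟨s(k, l), heE⟩) rfl he').exists_evenClosedWalk
      q.succ_pos

/-! ### Monomials of the Rees algebra and generators of the toric ideal -/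

section Rees

variable (K : Type*) [Field K]

/-- The monomial `x^a y^u` of `K[x][y]`. -/
noncomputable def bimonomial (a : V →₀ ℕ) (u : E →₀ ℕ) :
    MvPolynomial E (MvPolynomial V K) :=
  MvPolynomial.monomial u (MvPolynomial.monomial a 1)

variable (E) in
/-- The monomials `x_i x_j` of the edges. -/
noncomputable def edgeMonomial (e : E) : MvPolynomial V K :=
  MvPolynomial.monomial (ends e.1) 1

variable (E) in
lemma span_edgeMonomial :
    Ideal.span (Set.range (edgeMonomial E K)) = edgeIdeal K E := by
  rw [edgeIdeal]
  congr 1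
  ext p
  constructor
  · rintro ⟨⟨e, he⟩, rfl⟩
    induction e with
    | h i j => exact ⟨i, j, he, by simp [edgeMonomial, MvPolynomial.X, MvPolynomial.monomial_mul]⟩
  · rintro ⟨i, j, he, rfl⟩
    exact ⟨⟨_, he⟩, by simp [edgeMonomial, MvPolynomial.X, MvPolynomial.monomial_mul]⟩

lemma bimonomial_add (a b : V →₀ ℕ) (u v : E →₀ ℕ) :
    bimonomial K (a + b) (u + v) = bimonomial K a u * bimonomial K b v := by
  simp [bimonomial, MvPolynomial.monomial_mul]

lemma reesHom_bimonomial (a : V →₀ ℕ) (u : E →₀ ℕ) :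
    reesHom (edgeMonomial E K) (bimonomial K a u) =
      Polynomial.monomial u.degree (MvPolynomial.monomial (a + vertexDegree u) 1) := by
  have h0 (u : E →₀ ℕ) : bimonomial K a u =
      MvPolynomial.C (MvPolynomial.monomial a 1) * bimonomial K 0 u := by
    simp [bimonomial, MvPolynomial.C_mul_monomial]
  have h1 (u : E →₀ ℕ) : reesHom (edgeMonomial E K) (bimonomial K 0 u) =
      Polynomial.monomial u.degree (MvPolynomial.monomial (vertexDegree u) 1) := by
    induction u using Finsupp.induction_linear with
    | zero => simp [bimonomial, reesHom]
    | add u v hu hv =>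
      have := bimonomial_add K 0 0 u v
      rw [add_zero] at this
      rw [this, map_mul, hu, hv, Polynomial.monomial_mul_monomial,
        MvPolynomial.monomial_mul, map_add, map_add, one_mul]
    | single e n =>
      simp [bimonomial, reesHom, MvPolynomial.aeval_monomial, edgeMonomial, vertexDegree,
        mul_pow, MvPolynomial.monomial_pow, ← Polynomial.C_pow,
        ← Polynomial.C_mul_X_pow_eq_monomial]
  rw [h0, map_mul, h1, reesHom, MvPolynomial.algHom_C, Polynomial.algebraMap_eq,
    Polynomial.C_mul_monomial, MvPolynomial.monomial_mul, one_mul]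

variable {K} {Q : Ideal (MvPolynomial E (MvPolynomial V K))}

lemma mk_bimonomial_add {a b : V →₀ ℕ} {u v : E →₀ ℕ}
    (h : Ideal.Quotient.mk Q (bimonomial K a u) = Ideal.Quotient.mk Q (bimonomial K b v))
    (c : V →₀ ℕ) (w : E →₀ ℕ) :
    Ideal.Quotient.mk Q (bimonomial K (c + a) (w + u)) =
      Ideal.Quotient.mk Q (bimonomial K (c + b) (w + v)) := by
  rw [bimonomial_add, bimonomial_add, map_mul, map_mul, h]

lemma binomial_mem_ker (Γ : EvenClosedWalk E) :
    reesHom (edgeMonomial E K) (bimonomial K 0 Γ.plusExp - bimonomial K 0 Γ.minusExp) = 0 := by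
  have hd : Γ.plusExp.degree = Γ.minusExp.degree := by
    have := degree_vertexDegree Γ.plusExp
    rw [Γ.vertexDegree_plusExp, degree_vertexDegree] at this
    omega
  rw [map_sub, reesHom_bimonomial, reesHom_bimonomial, hd, Γ.vertexDegree_plusExp, sub_self]

/-- The binomials of the non-trivial primitive walks generate the toric ideal. -/
lemma mk_bimonomial_eq_of_primitive
    (hΓ : ∀ Γ : EvenClosedWalk E, ¬ Γ.IsTrivial K → Γ.IsPrimitive K →
      Ideal.Quotient.mk Q (bimonomial K 0 Γ.plusExp) =
        Ideal.Quotient.mk Q (bimonomial K 0 Γ.minusExp))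
    (n : ℕ) (u v : E →₀ ℕ) (hn : u.degree = n) (h : vertexDegree u = vertexDegree v) :
    Ideal.Quotient.mk Q (bimonomial K 0 u) = Ideal.Quotient.mk Q (bimonomial K 0 v) := by
  induction n using Nat.strong_induction_on generalizing u v with
  | _ n ih =>
    have split : ∀ Γ : EvenClosedWalk E, Γ.plusExp ≤ u → Γ.minusExp ≤ v →
        ¬ (Γ.plusExp = u ∧ Γ.minusExp = v) →
        Ideal.Quotient.mk Q (bimonomial K 0 u) = Ideal.Quotient.mk Q (bimonomial K 0 v) := by
      intro Γ hu hv hne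
      obtain ⟨u', rfl⟩ := exists_add_of_le hu
      obtain ⟨v', rfl⟩ := exists_add_of_le hv
      rw [map_add, map_add, Γ.vertexDegree_plusExp] at h
      have h' : vertexDegree u' = vertexDegree v' := add_left_cancel h
      have hd : u'.degree = v'.degree := by
        have := degree_vertexDegree u'
        rw [h', degree_vertexDegree] at this
        omega
      rw [map_add, Γ.degree_plusExp] at hn
      have hq := Γ.q_pos
      have h1 := ih u'.degree (by omega) u' v' rfl h'
      -- The remainders have equal degree, so neither is zero and the walk itself has degree below
      -- `n`.
      have h0 : u'.degree ≠ 0 := by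
        intro h0
        rw [h0] at hd
        rw [(Finsupp.degree_eq_zero_iff u').1 h0, (Finsupp.degree_eq_zero_iff v').1 hd.symm] at hne
        simp at hne
      have h2 := ih Γ.plusExp.degree (by rw [Γ.degree_plusExp]; omega) _ _ rfl
        Γ.vertexDegree_plusExp
      have e1 := bimonomial_add K (0 : V →₀ ℕ) 0 Γ.plusExp u'
      have e2 := bimonomial_add K (0 : V →₀ ℕ) 0 Γ.minusExp v'
      rw [add_zero] at e1 e2
      rw [e1, e2, map_mul, map_mul, h1, h2]
    by_cases hu : u = 0
    · subst hu
      have hv : v.degree = 0 := by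
        have := degree_vertexDegree v
        rw [← h] at this
        simpa using this
      rw [(Finsupp.degree_eq_zero_iff v).1 hv]
    obtain ⟨Γ, hΓu, hΓv⟩ := exists_evenClosedWalk_le h hu
    by_cases heq : Γ.plusExp = u ∧ Γ.minusExp = v
    · obtain ⟨rfl, rfl⟩ := heq
      by_cases ht : Γ.IsTrivial K
      · rw [(Γ.isTrivial_iff K).1 ht]
      by_cases hp : Γ.IsPrimitive K
      · exact hΓ Γ ht hp
      obtain ⟨Γ', hne, h1, h2⟩ := not_not.1 hp
      rw [Γ.hPlus_eq K, Γ'.hPlus_eq K, MvPolynomial.monomial_dvd_monomial] at h1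
      rw [Γ.hMinus_eq K, Γ'.hMinus_eq K, MvPolynomial.monomial_dvd_monomial] at h2
      refine split Γ' (h1.1.resolve_left one_ne_zero) (h2.1.resolve_left one_ne_zero) ?_
      -- A walk exhausting both `u` and `v` would have the binomial of `Γ`.
      rintro ⟨h3, h4⟩
      apply hne
      rw [EvenClosedWalk.h, EvenClosedWalk.h, Γ.hPlus_eq K, Γ'.hPlus_eq K, Γ.hMinus_eq K,
        Γ'.hMinus_eq K, h3, h4]
    · exact split Γ hΓu hΓv heq

/-! ### Exchanges of edges modulo the linear relations -/

variable [Fintype E]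

lemma mk_bimonomial_exchange (hQ : relationIdeal (edgeMonomial E K) ≤ Q) {a b : V →₀ ℕ}
    {e e' : E} (h : a + ends e.1 = b + ends e'.1) (w : E →₀ ℕ) :
    Ideal.Quotient.mk Q (bimonomial K a (single e 1 + w)) =
      Ideal.Quotient.mk Q (bimonomial K b (single e' 1 + w)) := by
  classical
  have key : Ideal.Quotient.mk Q (bimonomial K a (single e 1)) =
      Ideal.Quotient.mk Q (bimonomial K b (single e' 1)) := by
    rw [Ideal.Quotient.eq]
    apply hQ
    have := mem_relationIdeal (g := edgeMonomial E K)
      (fun i => (Pi.single e (MvPolynomial.monomial a 1) : E → MvPolynomial V K) i -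
        (Pi.single e' (MvPolynomial.monomial b 1) : E → MvPolynomial V K) i) (by
          simp [sub_mul, Finset.sum_sub_distrib, Pi.single_apply, edgeMonomial,
            MvPolynomial.monomial_mul, h])
    convert this using 1
    simp only [map_sub, sub_mul, Finset.sum_sub_distrib, MvPolynomial.C_mul_X_eq_monomial,
      bimonomial]
    congr 1 <;>
    · rw [Finset.sum_eq_single _ (fun i _ hi => by rw [Pi.single_eq_of_ne hi, map_zero])
        (fun hi => absurd (Finset.mem_univ _) hi), Pi.single_eq_same]
  have := mk_bimonomial_add key 0 w
  rwa [zero_add, zero_add, add_comm w, add_comm w] at this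

/-- For consecutive vertices `p, q, r` of the walk, `x_p y_{qr}` may be exchanged for `x_r y_{pq}`;
the variable thus moves two vertices on at each exchange. -/
lemma mk_bimonomial_chain (hQ : relationIdeal (edgeMonomial E K) ≤ Q) (Γ : EvenClosedWalk E)
    (s n : ℕ) :
    Ideal.Quotient.mk Q (bimonomial K (single (Γ.vertex s) 1)
      (∑ t ∈ Finset.range n, single (Γ.edge (s + 2 * t + 1)) 1)) =
    Ideal.Quotient.mk Q (bimonomial K (single (Γ.vertex (s + 2 * n)) 1)
      (∑ t ∈ Finset.range n, single (Γ.edge (s + 2 * t)) 1)) := by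
  induction n with
  | zero => simp
  | succ n ih =>
    have h1 := mk_bimonomial_add ih 0 (single (Γ.edge (s + 2 * n + 1)) 1)
    rw [zero_add, zero_add] at h1
    rw [Finset.sum_range_succ, Finset.sum_range_succ, add_comm, h1, add_comm (∑ _ ∈ _, _)]
    refine mk_bimonomial_exchange hQ ?_ _
    simp only [EvenClosedWalk.coe_edge, ends_mk, mul_add, mul_one, ← add_assoc]
    abel

lemma mk_bimonomial_walk (hQ : relationIdeal (edgeMonomial E K) ≤ Q) (Γ : EvenClosedWalk E)
    {c d : V →₀ ℕ} {e : E} (s : ℕ) (h : c + single (Γ.vertex s) 1 = d + ends e.1) :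
    Ideal.Quotient.mk Q (bimonomial K c Γ.plusExp) =
      Ideal.Quotient.mk Q (bimonomial K c Γ.minusExp) := by
  induction s generalizing Γ with
  | zero =>
    obtain ⟨n, hn⟩ := Nat.exists_eq_succ_of_ne_zero Γ.q_pos.ne'
    have hp : Γ.plusExp = single (Γ.edge 0) 1 +
        ∑ t ∈ Finset.range n, single (Γ.edge (1 + 2 * t + 1)) 1 := by
      rw [EvenClosedWalk.plusExp, hn, Finset.sum_range_succ', add_comm]
      congr 1
      refine Finset.sum_congr rfl fun t _ => ?_
      rw [show 2 * (t + 1) = 1 + 2 * t + 1 by ring]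
    have hm : Γ.minusExp = single (Γ.edge (1 + 2 * n)) 1 +
        ∑ t ∈ Finset.range n, single (Γ.edge (1 + 2 * t)) 1 := by
      rw [EvenClosedWalk.minusExp, hn, Finset.sum_range_succ, add_comm]
      simp only [add_comm 1]
    have hv : Γ.vertex (1 + 2 * n + 1) = Γ.vertex 0 := by
      have := Γ.periodic 0
      rw [hn] at this
      rw [← this]
      congr 1
      rw [Nat.succ_eq_add_one]; ring
    have h1 := mk_bimonomial_add (mk_bimonomial_chain hQ Γ 1 n) d (single e 1)
    rw [hp, hm]
    -- Trade the first edge of the walk for `e`, run the chain from vertex `1`, then trade `e` for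
    -- the last edge.
    refine (mk_bimonomial_exchange hQ ?_ _).trans (h1.trans (mk_bimonomial_exchange hQ ?_ _))
    · rw [EvenClosedWalk.coe_edge, ends_mk, zero_add, ← add_assoc, h]; abel
    · rw [EvenClosedWalk.coe_edge, ends_mk, hv, add_comm (single (Γ.vertex _) 1), ← add_assoc c, h]
      abel
  | succ s ih =>
    -- Rotation brings vertex `s + 1` to position `s` and swaps the two monomials, whence the
    -- symmetry.
    have := ih Γ.rotate h
    rw [EvenClosedWalk.plusExp_rotate, EvenClosedWalk.minusExp_rotate] at this
    exact this.symm

/-- The Rees ideal of an edge ideal is of fiber type. -/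
lemma mk_bimonomial_eq_of_toric (hQ : relationIdeal (edgeMonomial E K) ≤ Q)
    (hT : ∀ u v : E →₀ ℕ, vertexDegree u = vertexDegree v →
      Ideal.Quotient.mk Q (bimonomial K 0 u) = Ideal.Quotient.mk Q (bimonomial K 0 v))
    (n : ℕ) (a b : V →₀ ℕ) (u v : E →₀ ℕ) (hu : u.degree = n) (hv : v.degree = n)
    (h : a + vertexDegree u = b + vertexDegree v) :
    Ideal.Quotient.mk Q (bimonomial K a u) = Ideal.Quotient.mk Q (bimonomial K b v) := by
  classical
  induction n generalizing a b u v with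
  | zero =>
    rw [Finsupp.degree_eq_zero_iff] at hu hv
    subst hu hv
    rw [show a = b by simpa using h]
  | succ n ih =>
    by_cases hab : a ≤ b
    · obtain ⟨c, rfl⟩ := exists_add_of_le hab
      have h1 : vertexDegree u = c + vertexDegree v := by
        apply add_left_cancel (a := a)
        rw [h, add_assoc]
      have h2 := congrArg Finsupp.degree h1
      rw [map_add, degree_vertexDegree, degree_vertexDegree, hu, hv] at h2
      have hc : c = 0 := (Finsupp.degree_eq_zero_iff c).1 (by omega)
      rw [hc, zero_add] at h1
      have := mk_bimonomial_add (hT u v h1) a 0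
      simpa [hc] using this
    obtain ⟨i, hi⟩ : ∃ i, b i < a i := by
      by_contra! hcon
      exact hab hcon
    have hvi : vertexDegree v i ≠ 0 := by
      have := DFunLike.congr_fun h i
      simp only [Finsupp.add_apply] at this
      omega
    obtain ⟨e, j, v', he, rfl⟩ := exists_edge_of_vertexDegree_ne_zero hvi
    -- An exchange brings the edge `e = {i, j}` of `v` into `u`, so that it can be cancelled. The
    -- vertex `j` comes from an edge of `u` if possible, and otherwise from `x^a`, where any edge of
    -- `u` can be traded.
    obtain ⟨e₀, u', a', rfl, ha'⟩ : ∃ (e₀ : E) (u' : E →₀ ℕ) (a' : V →₀ ℕ),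
        u = single e₀ 1 + u' ∧ a + ends e₀.1 = a' + ends e.1 := by
      obtain ⟨a₁, rfl⟩ : ∃ a₁, a = single i 1 + a₁ :=
        exists_add_of_le (by rw [Finsupp.single_le_iff]; omega)
      by_cases huj : vertexDegree u j = 0
      · have hj : 1 ≤ a₁ j := by
          have := DFunLike.congr_fun h j
          simp only [map_add, vertexDegree_single, he, ends_mk, Finsupp.add_apply, huj,
            Finsupp.single_eq_same] at this
          omega
        obtain ⟨a₂, rfl⟩ : ∃ a₂, a₁ = single j 1 + a₂ :=
          exists_add_of_le (by rw [Finsupp.single_le_iff]; omega)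
        obtain ⟨e₀, u', rfl⟩ := exists_edge_of_ne_zero (u := u) (by rintro rfl; simp at hu)
        refine ⟨e₀, u', a₂ + ends e₀.1, rfl, ?_⟩
        rw [he, ends_mk]; abel
      · obtain ⟨e₀, l, u', he₀, rfl⟩ := exists_edge_of_vertexDegree_ne_zero huj
        refine ⟨e₀, u', a₁ + single l 1, rfl, ?_⟩
        rw [he, he₀, ends_mk, ends_mk]; abel
    rw [mk_bimonomial_exchange hQ ha']
    rw [map_add, Finsupp.degree_single] at hu hv
    have h' : a' + vertexDegree u' = b + vertexDegree v' := by
      rw [map_add, map_add, vertexDegree_single, vertexDegree_single] at h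
      apply add_right_cancel (b := ends e.1)
      rw [add_right_comm, ← ha', add_right_comm, add_assoc, add_assoc, add_comm _ (ends e₀.1), h,
        add_comm (ends e.1)]
    have := mk_bimonomial_add (ih a' b u' v' (by omega) (by omega) h') 0 (single e 1)
    rwa [zero_add, zero_add] at this

/-- The Rees ideal of an edge ideal is generated by the linear relations and the binomials of the
non-trivial primitive even closed walks. -/
lemma mem_of_reesHom_eq_zero (hQ : relationIdeal (edgeMonomial E K) ≤ Q)
    (hΓ : ∀ Γ : EvenClosedWalk E, ¬ Γ.IsTrivial K → Γ.IsPrimitive K →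
      bimonomial K 0 Γ.plusExp - bimonomial K 0 Γ.minusExp ∈ Q)
    {p : MvPolynomial E (MvPolynomial V K)} (hp : reesHom (edgeMonomial E K) p = 0) : p ∈ Q := by
  classical
  have key : ∀ (a b : V →₀ ℕ) (u v : E →₀ ℕ), u.degree = v.degree →
      a + vertexDegree u = b + vertexDegree v →
      Ideal.Quotient.mk Q (bimonomial K a u) = Ideal.Quotient.mk Q (bimonomial K b v) :=
    fun a b u v hd h => mk_bimonomial_eq_of_toric hQ
      (fun u v h => mk_bimonomial_eq_of_primitive
        (fun Γ ht hp => Ideal.Quotient.eq.2 (hΓ Γ ht hp)) _ u v rfl h) _ a b u v rfl hd.symm h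
  -- A `K`-linear map back from `R[t]` to the quotient by `Q`: by `key` the chosen preimage does not
  -- matter, and the value `0` off the image is arbitrary. Composed with `reesHom` it is the
  -- quotient map, so the kernel lies in `Q`.
  let τ : (V →₀ ℕ) × ℕ → MvPolynomial E (MvPolynomial V K) ⧸ Q := fun x =>
    if h : ∃ y : (V →₀ ℕ) × (E →₀ ℕ), y.1 + vertexDegree y.2 = x.1 ∧ y.2.degree = x.2 then
      Ideal.Quotient.mk Q (bimonomial K h.choose.1 h.choose.2) else 0
  have hτ : ∀ a u, τ (a + vertexDegree u, u.degree) = Ideal.Quotient.mk Q (bimonomial K a u) := by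
    intro a u
    have h : ∃ y : (V →₀ ℕ) × (E →₀ ℕ),
      y.1 + vertexDegree y.2 = a + vertexDegree u ∧ y.2.degree = u.degree := ⟨(a, u), rfl, rfl⟩
    simp only [τ]
    rw [dif_pos h]
    exact key _ _ _ _ h.choose_spec.2 h.choose_spec.1
  let B := (MvPolynomial.basisMonomials V K).smulTower
    (Polynomial.basisMonomials (MvPolynomial V K))
  let σ := B.constr K τ
  have hσ : ∀ b n, σ (Polynomial.monomial n (MvPolynomial.monomial b 1)) = τ (b, n) := by
    intro b n
    rw [← B.constr_basis K τ (b, n)]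
    simp [B, σ, Module.Basis.smulTower_apply, Polynomial.smul_monomial]
  have hfac : ∀ p, σ (reesHom (edgeMonomial E K) p) = Ideal.Quotient.mk Q p := by
    intro p
    induction p using MvPolynomial.induction_on' with
    | add p q hp hq => rw [map_add, map_add, map_add, hp, hq]
    | monomial u c =>
      induction c using MvPolynomial.induction_on' with
      | add c d hc hd => simp only [map_add, hc, hd]
      | monomial a k =>
        have h1 : MvPolynomial.monomial u (MvPolynomial.monomial a k) = k • bimonomial K a u := by
          simp [bimonomial, MvPolynomial.smul_monomial]
        rw [h1, ← AlgHom.coe_restrictScalars' K, map_smul, AlgHom.coe_restrictScalars', map_smul,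
          reesHom_bimonomial, hσ, hτ]
        exact ((Ideal.Quotient.mkₐ K Q).toLinearMap.map_smul k _).symm
  rw [← Ideal.Quotient.eq_zero_iff_mem, ← hfac, hp, map_zero]

/-- A monomial `x^a y^u` to which no exchange of edges applies does not occur in the ideal of
linear relations. -/
lemma coeff_eq_zero_of_mem_relationIdeal {a : V →₀ ℕ} {u : E →₀ ℕ}
    (h : ∀ e ∈ u.support, ∀ e' : E, e' ≠ e → ¬ ends e'.1 ≤ a + ends e.1)
    {p : MvPolynomial E (MvPolynomial V K)} (hp : p ∈ relationIdeal (edgeMonomial E K)) :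
    (p.coeff u).coeff a = 0 := by
  classical
  -- Vanishing at all divisors of `x^a y^u` is inherited by multiples of `p`.
  suffices hs : ∀ a' ≤ a, ∀ u' ≤ u, (p.coeff u').coeff a' = 0 from hs a le_rfl u le_rfl
  induction hp using Submodule.span_induction with
  | zero => simp
  | add p q _ _ hp hq =>
    intro a' ha u' hu
    rw [MvPolynomial.coeff_add, MvPolynomial.coeff_add, hp a' ha u' hu, hq a' ha u' hu, add_zero]
  | smul r p _ hp =>
    intro a' ha u' hu
    rw [smul_eq_mul, MvPolynomial.coeff_mul, MvPolynomial.coeff_sum]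
    refine Finset.sum_eq_zero fun x hx => ?_
    rw [MvPolynomial.coeff_mul]
    refine Finset.sum_eq_zero fun y hy => ?_
    rw [Finset.HasAntidiagonal.mem_antidiagonal] at hx hy
    rw [hp y.2 (le_trans (hy ▸ le_add_self) ha) x.2 (le_trans (hx ▸ le_add_self) hu), mul_zero]
  | mem p hp =>
    obtain ⟨c, hc, rfl⟩ := hp
    intro a' ha u' hu
    simp only [MvPolynomial.C_mul_X_eq_monomial, MvPolynomial.coeff_sum,
      MvPolynomial.coeff_monomial]
    by_cases hex : ∃ e, single e 1 = u'
    · obtain ⟨e, rfl⟩ := hex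
      have he : e ∈ u.support := by
        rw [Finsupp.mem_support_iff]
        rw [Finsupp.single_le_iff] at hu
        omega
      -- In this coefficient of the relation only the summand of `e` survives, since no other edge
      -- monomial divides `x^{a'} f_e`.
      have h1 := congrArg (MvPolynomial.coeff (a' + ends e.1)) hc
      rw [MvPolynomial.coeff_sum, Finset.sum_eq_single e] at h1
      · rw [edgeMonomial, MvPolynomial.coeff_mul_monomial, mul_one, MvPolynomial.coeff_zero] at h1
        rw [Finset.sum_eq_single e]
        · simpa using h1
        · intro e' _ hne
          rw [if_neg, MvPolynomial.coeff_zero]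
          intro heq
          exact hne (Finsupp.single_left_injective one_ne_zero heq)
        · simp
      · intro e' _ hne
        rw [edgeMonomial, MvPolynomial.coeff_mul_monomial', if_neg]
        exact fun hle => h e he e' hne (hle.trans (add_le_add ha le_rfl))
      · simp
    · refine Finset.sum_eq_zero fun e _ => ?_
      rw [if_neg fun h => hex ⟨e, h⟩, MvPolynomial.coeff_zero]

/-! ### Multiples of a walk binomial among the linear relations -/

lemma eq_of_ends_le {e e' : Sym2 V} (h : ends e' ≤ ends e) : e' = e := by
  classical
  induction e' with
  | h i j =>
    have hi := h i
    obtain ⟨l, rfl⟩ := exists_eq_mk_of_ends_ne_zero (e := e) (i := i) (by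
      simp only [ends_mk, Finsupp.add_apply, Finsupp.single_eq_same] at hi
      omega)
    have hj := add_le_add_iff_left _ |>.1 h
    rw [Finsupp.single_le_iff] at hj
    by_cases hjl : j = l
    · rw [hjl]
    · rw [Finsupp.single_eq_of_ne hjl] at hj
      omega

lemma not_ends_le_add {a : V →₀ ℕ} {e e' : Sym2 V} (hne : e' ≠ e) (h1 : ¬ ends e' ≤ a)
    (h2 : ∀ i j, e' = s(i, j) → a i ≠ 0 → ends e j = 0) : ¬ ends e' ≤ a + ends e := by
  classical
  intro hle
  -- If `a` met `e'` at one end, the other end would get nothing from `e`, so all of `e'` would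
  -- divide `x^a`.
  have aux : ∀ i j, e' = s(i, j) → a i = 0 := by
    rintro i j rfl
    by_contra hi
    apply h1
    have hj := h2 i j rfl hi
    have hlj := hle j
    intro x
    by_cases hx : x = j
    · subst hx
      simpa [hj] using hlj
    · by_cases hxi : x = i
      · subst hxi
        simp only [ends_mk, Finsupp.add_apply, Finsupp.single_eq_same,
          Finsupp.single_eq_of_ne hx]
        omega
      · simp [Finsupp.single_eq_of_ne hx, Finsupp.single_eq_of_ne hxi]
  refine hne (eq_of_ends_le fun x => ?_)
  by_cases hx : ends e' x = 0
  · simp [hx]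
  · obtain ⟨j, hj⟩ := exists_eq_mk_of_ends_ne_zero hx
    simpa [aux x j hj] using hle x

lemma C_mul_mem_of_mem_span {R ι : Type*} [CommRing R] {L : Ideal (MvPolynomial ι R)} {S : Set R}
    {p : MvPolynomial ι R} (h : ∀ s ∈ S, MvPolynomial.C s * p ∈ L) {r : R}
    (hr : r ∈ Ideal.span S) : MvPolynomial.C r * p ∈ L := by
  induction hr using Submodule.span_induction with
  | mem s hs => exact h s hs
  | zero => simp
  | add x y _ _ hx hy => rw [map_add, add_mul]; exact add_mem hx hy
  | smul c x _ hx => rw [smul_eq_mul, map_mul, mul_assoc]; exact L.mul_mem_left _ hx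

lemma monomial_mul_binomial_mem (Γ : EvenClosedWalk E) {c d : V →₀ ℕ} {e : E} (s : ℕ)
    (h : c + single (Γ.vertex s) 1 = d + ends e.1) :
    MvPolynomial.C (MvPolynomial.monomial c (1 : K)) *
      (bimonomial K 0 Γ.plusExp - bimonomial K 0 Γ.minusExp) ∈
      relationIdeal (edgeMonomial E K) := by
  have := Ideal.Quotient.eq.1 (mk_bimonomial_walk (K := K) le_rfl Γ s h)
  simpa [bimonomial, mul_sub, MvPolynomial.C_mul_monomial] using this

lemma mul_binomial_mem_of_mem_edgeIdeal (Γ : EvenClosedWalk E) {r : MvPolynomial V K}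
    (hr : r ∈ edgeIdeal K E) :
    MvPolynomial.C r * (bimonomial K 0 Γ.plusExp - bimonomial K 0 Γ.minusExp) ∈
      relationIdeal (edgeMonomial E K) := by
  rw [← span_edgeMonomial] at hr
  refine C_mul_mem_of_mem_span ?_ hr
  rintro _ ⟨e, rfl⟩
  exact monomial_mul_binomial_mem Γ (e := e) (d := single (Γ.vertex 0) 1) 0 (add_comm _ _)

lemma mul_binomial_mem_of_mem_nbhdIdeal (Γ : EvenClosedWalk E) {r : MvPolynomial V K}
    (hr : r ∈ Γ.nbhdIdeal K) :
    MvPolynomial.C r * (bimonomial K 0 Γ.plusExp - bimonomial K 0 Γ.minusExp) ∈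
      relationIdeal (edgeMonomial E K) := by
  refine C_mul_mem_of_mem_span ?_ hr
  rintro _ ⟨i, ⟨k, hk⟩, rfl⟩
  exact monomial_mul_binomial_mem Γ (e := ⟨_, hk⟩) (d := 0) k (by simp)

/-- If `r h_Γ` is a combination of linear relations, then each monomial of `r` is divisible by the
monomial of an edge or by a variable adjacent to `Γ`. -/
lemma exists_of_mul_binomial_mem {Γ : EvenClosedWalk E} (hΓ : ¬ Γ.IsTrivial K)
    {r : MvPolynomial V K}
    (h : MvPolynomial.C r * (bimonomial K 0 Γ.plusExp - bimonomial K 0 Γ.minusExp) ∈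
      relationIdeal (edgeMonomial E K))
    {a : V →₀ ℕ} (ha : a ∈ r.support) (hE : ∀ e ∈ E, ¬ ends e ≤ a) :
    ∃ i, a i ≠ 0 ∧ ∃ k, s(i, Γ.vertex k) ∈ E := by
  classical
  by_contra! hcon
  rw [Γ.isTrivial_iff K] at hΓ
  have h0 := coeff_eq_zero_of_mem_relationIdeal (a := a) (u := Γ.plusExp) (fun e he e' hne => by
    obtain ⟨k, rfl⟩ := Γ.exists_of_mem_support_plusExp he
    refine not_ends_le_add (fun h => hne (Subtype.ext h)) (hE _ e'.2) fun i j hij hi => ?_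
    by_contra hj
    obtain ⟨l, hl⟩ := exists_eq_mk_of_ends_ne_zero hj
    rw [EvenClosedWalk.coe_edge] at hl
    have hmem := e'.2
    rw [hij] at hmem
    rcases Sym2.eq_iff.1 hl with ⟨rfl, -⟩ | ⟨-, rfl⟩
    · exact hcon i hi _ hmem
    · exact hcon i hi _ hmem) h
  rw [MvPolynomial.coeff_C_mul, MvPolynomial.coeff_sub, bimonomial, bimonomial,
    MvPolynomial.coeff_monomial, MvPolynomial.coeff_monomial, if_pos rfl, if_neg (Ne.symm hΓ)] at h0
  rw [MvPolynomial.mem_support_iff] at ha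
  apply ha
  simpa using h0

lemma monomial_mem_of_le {I : Ideal (MvPolynomial V K)} {a b : V →₀ ℕ} (hab : a ≤ b)
    (ha : MvPolynomial.monomial a (1 : K) ∈ I) (k : K) : MvPolynomial.monomial b k ∈ I := by
  obtain ⟨c, rfl⟩ := exists_add_of_le hab
  have := I.mul_mem_left (MvPolynomial.monomial c k) ha
  rwa [MvPolynomial.monomial_mul, mul_one, add_comm] at this

end Rees

end Graph

end EdgeConductor

open EdgeConductor in
theorem mainTheorem6 {K : Type*} [Field K] {V : Type*} [Finite V] (E : Set (Sym2 V))
    {m : ℕ} (f : Fin m → MvPolynomial V K)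
    (hf : Ideal.span (Set.range f) = EdgeConductor.edgeIdeal K E) :
    EdgeConductor.conductor f =
      EdgeConductor.edgeIdeal K E ⊔
        ⨅ Γ ∈ {Γ : EdgeConductor.EvenClosedWalk E | ¬ Γ.IsTrivial K ∧ Γ.IsPrimitive K},
          Γ.nbhdIdeal K := by
  have : Fintype E := Fintype.ofFinite E
  rw [← span_edgeMonomial] at hf
  ext r
  rw [mem_conductor_iff hf]
  constructor
  · intro h
    rw [r.as_sum]
    refine sum_mem fun a ha => ?_
    by_cases hE : ∃ e ∈ E, ends e ≤ a
    · obtain ⟨e, he, hle⟩ := hE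
      refine Ideal.mem_sup_left (monomial_mem_of_le hle ?_ _)
      rw [← span_edgeMonomial]
      exact Ideal.subset_span ⟨⟨e, he⟩, rfl⟩
    · push Not at hE
      refine Ideal.mem_sup_right ?_
      simp only [Ideal.mem_iInf, Set.mem_ofPred_eq]
      rintro Γ ⟨hΓ, -⟩
      obtain ⟨i, hi, hk⟩ := exists_of_mul_binomial_mem hΓ (h _ (binomial_mem_ker Γ)) ha hE
      refine monomial_mem_of_le (a := Finsupp.single i 1) ?_
        (show MvPolynomial.X i ∈ Γ.nbhdIdeal K from Ideal.subset_span ⟨i, hk, rfl⟩) _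
      rw [Finsupp.single_le_iff]
      omega
  · intro hr p hp
    -- With the colon ideal `L : r` as `Q`, only the generators of `J` need to be multiplied by `r`.
    let Q : Ideal (MvPolynomial E (MvPolynomial V K)) :=
      (relationIdeal (edgeMonomial E K)).colon {MvPolynomial.C r}
    suffices h : p ∈ Q by
      rw [Submodule.mem_colon_singleton, smul_eq_mul] at h
      rwa [mul_comm]
    refine mem_of_reesHom_eq_zero (fun x hx => ?_) (fun Γ ht hΓ => ?_) hp
    · rw [Submodule.mem_colon_singleton]
      exact Ideal.mul_mem_right _ _ hx
    · rw [Submodule.mem_colon_singleton, smul_eq_mul, mul_comm]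
      obtain ⟨x, hx, y, hy, rfl⟩ := Submodule.mem_sup.1 hr
      simp only [Ideal.mem_iInf, Set.mem_ofPred_eq] at hy
      rw [map_add, add_mul]
      exact add_mem (mul_binomial_mem_of_mem_edgeIdeal Γ hx)
        (mul_binomial_mem_of_mem_nbhdIdeal Γ (hy Γ ⟨ht, hΓ⟩))
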